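/- All systems are finite-dimensional Hilbert spaces of dimension at least $1$, with fixed orthonormal bases; a channel is a completely positive trace-preserving map, identified with its Choi matrix $\sum_{i,j}M(|i\rangle\langle j|)\otimes|i\rangle\langle j|$, and $M*N=\mathrm{Tr}_s[M^{T_s}N]$ ($s$ the shared systems) is the link product. For an operator $W$ write ${}_XW=\frac{1}{d_X}\mathbb 1^X\otimes\mathrm{Tr}_XW$. A (bipartite) process matrix on $A_I\otimes A_O\otimes B_I\otimes B_O$ is an operator $W\ge 0$ with $\mathrm{Tr}\,W=d_{A_O}d_{B_O}$, ${}_{B_IB_O}W={}_{A_OB_IB_O}W$, ${}_{A_IA_O}W={}_{B_OA_IA_O}W$ and $W={}_{A_O}W+{}_{B_O}W-{}_{A_OB_O}W$. Composed with local channels $A:A_IA_I'\to A_OA_O'$ and $B:B_IB_I'\to B_OB_O'$ it gives the channel $N=W*(A\otimes B)$ from $A_I'B_I'$ to $A_O'B_O'$. We write $W^{A\prec B}$ for a process matrix that cannot be used to signal from Bob to Alice, i.e. for every channel $A$ of Alice (with arbitrary ancillas) the resulting channel $W*(A\otimes B)$ from $A_I'$ to $A_O'$ does not depend on the channel $B:B_I\to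 B_O$ that Bob applies; $W^{A\succ B}$ is defined in the same way with Alice and Bob exchanged. For $n\ge1$, a protocol from Alice to Bob with $n$ uses of $W$ and message dimension $m\ge1$ consists of channels $A_i:A_IA_I'^{\,i}\to A_O$ and $B_i:B_IB_I'^{\,i}\to B_OB_O'^{\,i}$ for $i=1,\dots,n$, an encoding channel $E_A$ from $\mathbb C^m$ to $\bigotimes_iA_I'^{\,i}$, a state $E_B$ on $\bigotimes_iB_I'^{\,i}$ and a decoding channel $D_B$ from $\bigotimes_iB_O'^{\,i}$ to $\mathbb C^m$. With $N_i=W*(A_i\otimes B_i)$ it sends a state $\sigma^{CA}$ on $\mathbb C^m\otimes\mathbb C^m$, whose first factor stays with a third party $C$, to the state $\rho=\big((\bigotimes_{i=1}^nN_i)*E_A*E_B*D_B\big)*\sigma$. It is an $(R,n,\epsilon)$ code if $\frac1n\log_2m\ge R$ and the fidelity satisfies $F(\sigma,\rho)=\big(\mathrm{Tr}\sqrt{\sqrt\sigma\,\rho\,\sqrt\sigma}\big)^2\ge1-\epsilon$ for every state $\sigma$ on $\mathbb C^m\otimes\mathbb C^m$. A rate $R$ is achievable if there are $(R,n,\epsilon_n)$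 codes for all $n\ge1$ with $\epsilon_n\to0$. The quantum communication capacity of $W$ from Alice to Bob is the supremum of the achievable rates, and the capacity from Bob to Alice is defined with the roles of Alice and Bob exchanged. **Corollary.** Let $0\le p\le1$, let $W^{A\prec B}$ and $W^{A\succ B}$ be process matrices on the same systems $A_I,A_O,B_I,B_O$ such that $W^{A\prec B}$ cannot be used to signal from Bob to Alice and $W^{A\succ B}$ cannot be used to signal from Alice to Bob, and let $W=pW^{A\prec B}+(1-p)W^{A\succ B}$. Then $W$ has positive quantum communication capacity in at most one direction: its capacity from Alice to Bob and its capacity from Bob to Alice are not both positive. -/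

import Mathlib

open scoped Matrix Topology ComplexOrder

noncomputable section

/-!
Every finite-dimensional Hilbert space is `ℂ^X` for a finite index type `X`; operators on it are
matrices indexed by `X`, and tensor products of spaces are products of index types.
-/

namespace CausalComm

/-- A density matrix: positive semidefinite with unit trace. -/
structure IsState {X : Type*} [Fintype X] (ρ : Matrix X X ℂ) : Prop where
  posSemidef : ρ.PosSemidef
  trace_eq : ρ.trace = 1

/-- Partial trace over the output system of a Choi matrix indexed by (output, input). -/
def traceOut {Y X : Type*} [Fintype Y] (M : Matrix (Y × X) (Y × X) ℂ) : Matrix X X ℂ :=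
  Matrix.of fun x x' => ∑ y, M (y, x) (y, x')

/-- `M` is the Choi matrix `∑ i j, M(|i⟩⟨j|) ⊗ |i⟩⟨j|` of a completely positive trace preserving
map from the system `X` to the system `Y`; the index is (output, input). -/
structure IsChannel {Y X : Type*} [Fintype Y] [DecidableEq X]
    (M : Matrix (Y × X) (Y × X) ℂ) : Prop where
  posSemidef : M.PosSemidef
  traceOut_eq : traceOut M = 1

/-- The (squared) Uhlmann fidelity `(Tr √(√σ ρ √σ))²` of two states. -/
def fidelity {X : Type*} [Fintype X] [DecidableEq X] (σ ρ : Matrix X X ℂ) : ℝ :=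
  (cfc Real.sqrt (cfc Real.sqrt σ * ρ * cfc Real.sqrt σ)).trace.re ^ 2

/-- Operators on `A_I ⊗ A_O ⊗ B_I ⊗ B_O`, bracketed as Alice's pair and Bob's pair. -/
abbrev ProcOp (AI AO BI BO : Type*) : Type _ :=
  Matrix ((AI × AO) × (BI × BO)) ((AI × AO) × (BI × BO)) ℂ

section Operators

variable {AI AO BI BO : Type*}

/-- The same operator with the roles of Alice and Bob exchanged. -/
def swapParties (W : ProcOp AI AO BI BO) : ProcOp BI BO AI AO :=
  W.submatrix Prod.swap Prod.swap

variable [Fintype AI] [Fintype AO] [Fintype BI] [Fintype BO]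

/-- Trace-and-replace on `A_I`: `(1/d) id ⊗ Tr W`. -/
def replAI [DecidableEq AI] (W : ProcOp AI AO BI BO) : ProcOp AI AO BI BO :=
  Matrix.of fun k l => if k.1.1 = l.1.1 then
    (∑ x, W ((x, k.1.2), k.2) ((x, l.1.2), l.2)) / (Fintype.card AI : ℂ) else 0

/-- Trace-and-replace on `A_O`. -/
def replAO [DecidableEq AO] (W : ProcOp AI AO BI BO) : ProcOp AI AO BI BO :=
  Matrix.of fun k l => if k.1.2 = l.1.2 then
    (∑ x, W ((k.1.1, x), k.2) ((l.1.1, x), l.2)) / (Fintype.card AO : ℂ) else 0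

/-- Trace-and-replace on `B_I`. -/
def replBI [DecidableEq BI] (W : ProcOp AI AO BI BO) : ProcOp AI AO BI BO :=
  Matrix.of fun k l => if k.2.1 = l.2.1 then
    (∑ x, W (k.1, (x, k.2.2)) (l.1, (x, l.2.2))) / (Fintype.card BI : ℂ) else 0

/-- Trace-and-replace on `B_O`. -/
def replBO [DecidableEq BO] (W : ProcOp AI AO BI BO) : ProcOp AI AO BI BO :=
  Matrix.of fun k l => if k.2.2 = l.2.2 then
    (∑ x, W (k.1, (k.2.1, x)) (l.1, (l.2.1, x))) / (Fintype.card BO : ℂ) else 0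

/-- Bipartite process matrices. -/
structure IsProcessMatrix [DecidableEq AI] [DecidableEq AO] [DecidableEq BI] [DecidableEq BO]
    (W : ProcOp AI AO BI BO) : Prop where
  posSemidef : W.PosSemidef
  trace_eq : W.trace = (Fintype.card AO : ℂ) * (Fintype.card BO : ℂ)
  marginalA : replBI (replBO W) = replAO (replBI (replBO W))
  marginalB : replAI (replAO W) = replBO (replAI (replAO W))
  no_loops : W = replAO W + replBO W - replAO (replBO W)

/-- The Choi matrix, with inputs `A_I', B_I'` and outputs `A_O', B_O'`, of `W * (A ⊗ B)`, the
composition of a process with local operations `A : A_I A_I' → A_O A_O'` and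
`B : B_I B_I' → B_O B_O'`.  The link product `M * N = Tr_s [M^{T_s} N]` contracts the row indices
of `M` with the row indices of `N` on the shared systems, and likewise the column indices. -/
def useProcess {AI' AO' BI' BO' : Type*} (W : ProcOp AI AO BI BO)
    (A : Matrix ((AO × AO') × (AI × AI')) ((AO × AO') × (AI × AI')) ℂ)
    (B : Matrix ((BO × BO') × (BI × BI')) ((BO × BO') × (BI × BI')) ℂ) :
    Matrix ((AO' × BO') × (AI' × BI')) ((AO' × BO') × (AI' × BI')) ℂ :=
  Matrix.of fun u v => ∑ k : (AI × AO) × (BI × BO), ∑ l : (AI × AO) × (BI × BO),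
    W k l * A ((k.1.2, u.1.1), (k.1.1, u.2.1)) ((l.1.2, v.1.1), (l.1.1, v.2.1)) *
      B ((k.2.2, u.1.2), (k.2.1, u.2.2)) ((l.2.2, v.1.2), (l.2.1, v.2.2))

/-- `W` cannot be used to signal from Bob to Alice: whatever Alice does (with arbitrary ancillas),
the channel she obtains does not depend on the channel that Bob applies. -/
def NoSignalBtoA [DecidableEq AI] [DecidableEq BI] (W : ProcOp AI AO BI BO) : Prop :=
  ∀ (d d' : ℕ)
    (A : Matrix ((AO × Fin d') × (AI × Fin d)) ((AO × Fin d') × (AI × Fin d)) ℂ)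
    (B₁ B₂ : Matrix ((BO × Unit) × (BI × Unit)) ((BO × Unit) × (BI × Unit)) ℂ),
    IsChannel A → IsChannel B₁ → IsChannel B₂ → useProcess W A B₁ = useProcess W A B₂

/-- `W` cannot be used to signal from Alice to Bob. -/
def NoSignalAtoB [DecidableEq AI] [DecidableEq BI] (W : ProcOp AI AO BI BO) : Prop :=
  NoSignalBtoA (swapParties W)

end Operators

/-- A protocol with `n` uses of a process that transmits an `m`-dimensional system from Alice to
Bob.  In the `i`-th use Alice's ancilla has input dimension `aIn i` (and trivial output), Bob's
ancilla has input dimension `bIn i` and output dimension `bOut i`. -/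
structure Protocol (AI AO BI BO : Type*) [Fintype AI] [Fintype AO] [Fintype BI] [Fintype BO]
    [DecidableEq AI] [DecidableEq BI] (n m : ℕ) where
  aIn : Fin n → ℕ
  bIn : Fin n → ℕ
  bOut : Fin n → ℕ
  /-- Alice's local channels, acting independently on the copies. -/
  A : ∀ i, Matrix ((AO × Unit) × (AI × Fin (aIn i))) ((AO × Unit) × (AI × Fin (aIn i))) ℂ
  isChannel_A : ∀ i, IsChannel (A i)
  /-- Bob's local channels, acting independently on the copies. -/
  B : ∀ i, Matrix ((BO × Fin (bOut i)) × (BI × Fin (bIn i)))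
    ((BO × Fin (bOut i)) × (BI × Fin (bIn i))) ℂ
  isChannel_B : ∀ i, IsChannel (B i)
  /-- Alice's joint encoding of the message system into her `n` ancilla inputs. -/
  EA : Matrix ((∀ i, Fin (aIn i)) × Fin m) ((∀ i, Fin (aIn i)) × Fin m) ℂ
  isChannel_EA : IsChannel EA
  /-- The joint state which Bob feeds into his `n` ancilla inputs. -/
  EB : Matrix (∀ i, Fin (bIn i)) (∀ i, Fin (bIn i)) ℂ
  isState_EB : IsState EB
  /-- Bob's joint decoding of his `n` ancilla outputs. -/
  DB : Matrix (Fin m × (∀ i, Fin (bOut i))) (Fin m × (∀ i, Fin (bOut i))) ℂ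
  isChannel_DB : IsChannel DB

section Capacity

variable {AI AO BI BO : Type*} [Fintype AI] [Fintype AO] [Fintype BI] [Fintype BO]
  [DecidableEq AI] [DecidableEq BI]

/-- The Choi matrix of `(N₁ ⊗ ⋯ ⊗ Nₙ) * E_A * E_B * D_B`, `N_i = W * (A_i ⊗ B_i)`, indexed by
(Bob's output, Alice's input). -/
def Protocol.overall {n m : ℕ} (P : Protocol AI AO BI BO n m) (W : ProcOp AI AO BI BO) :
    Matrix (Fin m × Fin m) (Fin m × Fin m) ℂ :=
  Matrix.of fun u v =>
    ∑ x : (∀ i, Fin (P.aIn i)), ∑ x' : (∀ i, Fin (P.aIn i)),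
    ∑ y : (∀ i, Fin (P.bIn i)), ∑ y' : (∀ i, Fin (P.bIn i)),
    ∑ z : (∀ i, Fin (P.bOut i)), ∑ z' : (∀ i, Fin (P.bOut i)),
      P.DB (u.1, z) (v.1, z') *
        (∏ i, useProcess W (P.A i) (P.B i)
          (((), z i), (x i, y i)) (((), z' i), (x' i, y' i))) *
        P.EA (x, u.2) (x', v.2) * P.EB y y'

/-- The final state of Charlie and Bob when the input `σ` is shared by Charlie and Alice. -/
def Protocol.output {n m : ℕ} (P : Protocol AI AO BI BO n m) (W : ProcOp AI AO BI BO)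
    (σ : Matrix (Fin m × Fin m) (Fin m × Fin m) ℂ) :
    Matrix (Fin m × Fin m) (Fin m × Fin m) ℂ :=
  Matrix.of fun u v => ∑ a, ∑ a', σ (u.1, a) (v.1, a') * P.overall W (u.2, a) (v.2, a')

/-- There is a code for entanglement transmission from Alice to Bob with `n` uses of `W`, with rate
`(1/n) log₂ m` at least `R` and with error at most `ε`. -/
def HasCode (W : ProcOp AI AO BI BO) (R : ℝ) (n : ℕ) (ε : ℝ) : Prop :=
  ∃ m : ℕ, 0 < m ∧ R ≤ (1 / (n : ℝ)) * Real.logb 2 m ∧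
    ∃ P : Protocol AI AO BI BO n m,
      ∀ σ : Matrix (Fin m × Fin m) (Fin m × Fin m) ℂ, IsState σ →
        1 - ε ≤ fidelity σ (P.output W σ)

/-- `R` is an achievable rate of quantum communication from Alice to Bob. -/
def Achievable (W : ProcOp AI AO BI BO) (R : ℝ) : Prop :=
  ∃ ε : ℕ → ℝ, Filter.Tendsto ε Filter.atTop (𝓝 0) ∧ ∀ n : ℕ, 1 ≤ n → HasCode W R n (ε n)

/-- The quantum communication capacity of `W` from Alice to Bob. -/
def capacityAtoB (W : ProcOp AI AO BI BO) : EReal :=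
  sSup ((fun R : ℝ => (R : EReal)) '' {R : ℝ | Achievable W R})

/-- The quantum communication capacity of `W` from Bob to Alice. -/
def capacityBtoA (W : ProcOp AI AO BI BO) : EReal :=
  capacityAtoB (swapParties W)

end Capacity

end CausalComm

end

/-! The obstruction is no-cloning. Exchanging the parties also exchanges `p` and `1 - p`, so it is
enough to show that Alice cannot send quantum information to Bob when `p ≤ 1/2`. Then `W` is an
equal mixture of the process `2p W₁ + (1 - 2p) W₂` and of `W₂`, where `W₂` does not let Alice signal
to Bob. For fixed local operations, each use of `W` is therefore half a channel `N` and half a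
channel that discards Alice's ancilla and applies some `M` to Bob's ancilla alone.

Such a mixture has a symmetric extension: give a second Bob his own copy of the ancilla, and toss a
fair coin to decide which Bob gets `N` while the other gets `M`. Each Bob separately sees exactly
the original channel (`isExtension_mixture`). Symmetric extensions survive products over the uses
(`isExtension_prod`), a common encoding, and identical ancilla states and decoders
(`sum_transmitTwo_right`, `sum_transmitTwo_left`). A code would thus deliver Alice's message to two
receivers at once.

For messages of dimension at least 2, `no_cloning` bounds the error below by `1/6`, matching the
fidelity `5/6` of the optimal universal qubit cloner. A positive rate forces such messages for every
`n`, so the error cannot tend to zero. -/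

noncomputable section

set_option linter.unusedSectionVars false

namespace CausalComm

/-! ### Positive kernels and their contractions -/

section PosSemidef

/-- Summing a positive semidefinite kernel over both copies of a subsystem. -/
theorem posSemidef_contract {S X : Type*} [Fintype S] [Fintype X]
    {K : Matrix (S × X) (S × X) ℂ} (hK : K.PosSemidef) :
    (Matrix.of fun u v => ∑ s, ∑ s', K (s, u) (s', v) : Matrix X X ℂ).PosSemidef := by
  classical
  -- The compressing matrix sends the basis vector `u` to the sum of all basis vectors `(s, u)`.
  have h := hK.conjTranspose_mul_mul_same
    (Matrix.of fun (q : S × X) (u : X) => if q.2 = u then (1 : ℂ) else 0)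
  convert h using 1
  ext u v
  simp only [Matrix.mul_apply, Matrix.conjTranspose_apply, Matrix.of_apply,
    Fintype.sum_prod_type, Finset.sum_mul]
  simp [apply_ite (starRingEnd ℂ)]
  rw [Finset.sum_comm]

theorem posSemidef_mul {X : Type*} {A B : Matrix X X ℂ} (hA : A.PosSemidef) (hB : B.PosSemidef) :
    (Matrix.of fun u v => A u v * B u v : Matrix X X ℂ).PosSemidef :=
  hA.hadamard hB

theorem posSemidef_prod {ι X : Type*} [Fintype ι] {K : ι → Matrix X X ℂ}
    (hK : ∀ i, (K i).PosSemidef) :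
    (Matrix.of fun u v => ∏ i, K i u v : Matrix X X ℂ).PosSemidef := by
  classical
  suffices ∀ s : Finset ι, (Matrix.of fun u v => ∏ i ∈ s, K i u v : Matrix X X ℂ).PosSemidef from
    this _
  intro s
  induction s using Finset.induction_on with
  | empty =>
    have h := (Matrix.PosSemidef.one (n := Unit) (R := ℂ)).submatrix (fun _ : X => ())
    have e : (Matrix.of fun u v => ∏ i ∈ ∅, K i u v : Matrix X X ℂ) =
        Matrix.submatrix (1 : Matrix Unit Unit ℂ) (fun _ => ()) (fun _ => ()) := by
      ext u v
      simp
    rw [e]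
    exact h
  | insert i s hi ih =>
    simp only [Finset.prod_insert hi]
    exact posSemidef_mul (hK i) ih

/-- The contraction of two kernels over a shared system. -/
def pair {P : Type*} [Fintype P] (D f : P → P → ℂ) : ℂ := ∑ p, ∑ p', D p p' * f p p'

variable {P Q : Type*} [Fintype P] [Fintype Q]

theorem posSemidef_pair {X : Type*} [Fintype X] {D f : Matrix (P × X) (P × X) ℂ}
    (hD : D.PosSemidef) (hf : f.PosSemidef) :
    (Matrix.of fun u v => pair (fun p p' => D (p, u) (p', v)) (fun p p' => f (p, u) (p', v)) :
      Matrix X X ℂ).PosSemidef := by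
  have h := posSemidef_contract (posSemidef_mul hD hf)
  simp only [Matrix.of_apply] at h
  exact h

theorem sum_pair {ι : Type*} (s : Finset ι) (D : P → P → ℂ) (f : ι → P → P → ℂ) :
    ∑ i ∈ s, pair D (f i) = pair D (fun p p' => ∑ i ∈ s, f i p p') := by
  simp only [pair, Finset.mul_sum]
  rw [Finset.sum_comm]
  refine Finset.sum_congr rfl fun p _ => ?_
  rw [Finset.sum_comm]

theorem sum_pair_left {ι : Type*} (s : Finset ι) (D : ι → P → P → ℂ) (f : P → P → ℂ) :
    ∑ i ∈ s, pair (D i) f = pair (fun p p' => ∑ i ∈ s, D i p p') f := by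
  simp only [pair, Finset.sum_mul]
  rw [Finset.sum_comm]
  refine Finset.sum_congr rfl fun p _ => ?_
  rw [Finset.sum_comm]

theorem pair_comm (D : P → P → ℂ) (D' : Q → Q → ℂ) (f : P → P → Q → Q → ℂ) :
    pair D (fun p p' => pair D' (f p p')) =
      pair D' (fun q q' => pair D (fun p p' => f p p' q q')) := by
  have h : ∀ p p', D p p' * pair D' (f p p') = pair D' (fun q q' => D p p' * f p p' q q') := by
    intro p p'
    simp only [pair, Finset.mul_sum]
    refine Finset.sum_congr rfl fun q _ => Finset.sum_congr rfl fun q' _ => by ring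
  rw [pair]
  simp only [h, sum_pair]
  rfl

theorem pair_symm (D f : P → P → ℂ) : pair D f = pair f D := by
  simp only [pair, mul_comm]

theorem pair_pair_left (D : P → P → ℂ) (f : Q → Q → P → P → ℂ) (g : Q → Q → ℂ) :
    pair (fun q q' => pair D (f q q')) g = pair D fun p p' => pair (fun q q' => f q q' p p') g := by
  simp only [pair_symm _ g]
  exact pair_comm g D f

theorem pair_delta [DecidableEq P] (f : P → P → ℂ) :
    pair (fun p p' => if p = p' then 1 else 0) f = ∑ p, f p p := by
  simp [pair]

theorem pair_ite [DecidableEq P] (D : P → P → ℂ) (c : ℂ) :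
    pair D (fun p p' => if p = p' then c else 0) = (∑ p, D p p) * c := by
  simp [pair, Finset.sum_mul]

theorem pair_zero (D : P → P → ℂ) : pair D (fun _ _ => 0) = 0 := by
  simp [pair]

theorem pair_ite_zero (q : Prop) [Decidable q] (D f : P → P → ℂ) :
    (pair D fun p p' => if q then f p p' else 0) = if q then pair D f else 0 := by
  split_ifs
  · rfl
  · exact pair_zero D

/-- A functional which is constant on states is a multiple of the trace. -/
theorem eq_delta_of_constant_on_states {X : Type*} [Fintype X] [DecidableEq X] (G : X → X → ℂ)
    (c : ℂ) (h : ∀ ρ : Matrix X X ℂ, IsState ρ → pair ρ G = c) (x x' : X) :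
    G x x' = if x = x' then c else 0 := by
  have hstate : ∀ φ : X → ℂ, ∑ a, φ a * star (φ a) = 1 →
      pair (fun a b => φ a * star (φ b)) G = c := fun φ hφ =>
    h (Matrix.vecMulVec φ (star φ)) ⟨Matrix.posSemidef_vecMulVec_self_star φ, by
      simpa [Matrix.trace, Matrix.vecMulVec_apply] using hφ⟩
  have hdiag : ∀ y, G y y = c := by
    intro y
    have := hstate (Pi.single y 1) (by simp [Pi.single_apply])
    simpa [pair, Pi.single_apply, apply_ite (starRingEnd ℂ)] using this
  split_ifs with hxx
  · rw [hxx, hdiag]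
  -- Polarization: test on the superpositions `(e_x + ω e_x')/√2` with `|ω| = 1`. The diagonal terms
  -- already account for `c`, so the cross terms cancel; `ω = 1` and `ω = i` together force both
  -- off-diagonal entries to vanish.
  obtain ⟨s, hs, hs2⟩ : ∃ s : ℂ, (starRingEnd ℂ) s = s ∧ s * s = 1 / 2 := by
    refine ⟨((1 / Real.sqrt 2 : ℝ) : ℂ), Complex.conj_ofReal _, ?_⟩
    rw [← Complex.ofReal_mul, div_mul_div_comm, Real.mul_self_sqrt (by norm_num)]
    norm_num
  have key : ∀ ω : ℂ, ω * star ω = 1 → star ω * G x x' + ω * G x' x = 0 := by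
    intro ω hω
    have hφ : ∀ f : X → ℂ, ∑ a, (Pi.single x s + Pi.single x' (s * ω) : X → ℂ) a * f a =
        s * f x + s * ω * f x' := by
      intro f
      simp [Pi.single_apply, add_mul, Finset.sum_add_distrib]
    have hφ' : ∀ f : X → ℂ, ∑ a, star ((Pi.single x s + Pi.single x' (s * ω) : X → ℂ) a) * f a =
        s * f x + s * star ω * f x' := by
      intro f
      simp [Pi.single_apply, add_mul, Finset.sum_add_distrib, apply_ite (starRingEnd ℂ), hs]
    have h1 := hstate (Pi.single x s + Pi.single x' (s * ω)) (by
      rw [hφ]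
      simp [hxx, Ne.symm hxx, hs]
      simp at hω
      linear_combination (1 + ω * (starRingEnd ℂ) ω) * hs2 + 1 / 2 * hω)
    simp only [pair, mul_assoc, ← Finset.mul_sum] at h1
    rw [hφ] at h1
    simp only [hφ', hdiag] at h1
    linear_combination 2 * h1 - (2 * (c + star ω * G x x' + ω * G x' x + ω * star ω * c)) * hs2
      - c * hω
  have h1 := key 1 (by simp)
  have h2 := key Complex.I (by simp)
  simp at h1 h2
  have h3 : Complex.I * (G x x' - G x' x) = 0 := by linear_combination -h2
  have h4 := (mul_eq_zero.1 h3).resolve_left Complex.I_ne_zero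
  linear_combination (h1 + h4) / 2

end PosSemidef

/-! ### Normalization of process matrices -/

section ProcessMatrices

variable {AI AO BI BO : Type*} [Fintype AI] [Fintype AO] [Fintype BI] [Fintype BO]

theorem replAO_replBO_comm [DecidableEq AO] [DecidableEq BO] (W : ProcOp AI AO BI BO) :
    replAO (replBO W) = replBO (replAO W) := by
  ext k l
  simp only [replAO, replBO, Matrix.of_apply]
  split_ifs
  · simp only [← Finset.sum_div]
    rw [Finset.sum_comm, div_right_comm]
  all_goals simp

theorem IsProcessMatrix.swap [DecidableEq AI] [DecidableEq AO] [DecidableEq BI] [DecidableEq BO]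
    {W : ProcOp AI AO BI BO} (hW : IsProcessMatrix W) : IsProcessMatrix (swapParties W) where
  posSemidef := hW.posSemidef.submatrix _
  trace_eq := by
    rw [mul_comm, ← hW.trace_eq]
    exact Equiv.sum_comp (Equiv.prodComm _ _) fun k => W k k
  marginalA := congrArg swapParties hW.marginalB
  marginalB := congrArg swapParties hW.marginalA
  no_loops := by
    have h := congrArg swapParties hW.no_loops
    rw [replAO_replBO_comm, add_comm] at h
    exact h

theorem posSemidef_useProcess {AI' AO' BI' BO' : Type*} [Fintype AI'] [Fintype AO'] [Fintype BI']
    [Fintype BO'] {W : ProcOp AI AO BI BO}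
    {A : Matrix ((AO × AO') × (AI × AI')) ((AO × AO') × (AI × AI')) ℂ}
    {B : Matrix ((BO × BO') × (BI × BI')) ((BO × BO') × (BI × BI')) ℂ}
    (hW : W.PosSemidef) (hA : A.PosSemidef) (hB : B.PosSemidef) :
    (useProcess W A B).PosSemidef := by
  let X := (AO' × BO') × (AI' × BI')
  have h1 := hW.submatrix (fun q : ((AI × AO) × (BI × BO)) × X => q.1)
  have h2 := hA.submatrix
    (fun q : ((AI × AO) × (BI × BO)) × X => ((q.1.1.2, q.2.1.1), (q.1.1.1, q.2.2.1)))
  have h3 := hB.submatrix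
    (fun q : ((AI × AO) × (BI × BO)) × X => ((q.1.2.2, q.2.1.2), (q.1.2.1, q.2.2.2)))
  have h := posSemidef_contract (posSemidef_mul (posSemidef_mul h1 h2) h3)
  simp only [Matrix.of_apply, Matrix.submatrix_apply] at h
  exact h

/-- The full contraction of `W` with kernels for Alice and Bob. -/
def contractBoth (W : ProcOp AI AO BI BO) (a : AI × AO → AI × AO → ℂ)
    (b : BI × BO → BI × BO → ℂ) : ℂ :=
  pair b fun k₂ l₂ => pair a fun k₁ l₁ => W (k₁, k₂) (l₁, l₂)

/-- The contraction of the reduced operator of Bob with a kernel. -/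
def contractBob (W : ProcOp AI AO BI BO) (b : BI × BO → BI × BO → ℂ) : ℂ :=
  pair b fun k₂ l₂ => ∑ k₁, W (k₁, k₂) (k₁, l₂)

/-- After trace-and-replace on `O` the kernel is a multiple of the identity there, so `a` enters
only through its partial trace over `O`, which is `α` times the identity. -/
theorem pair_replace {I O : Type*} [Fintype I] [Fintype O] [DecidableEq I] [DecidableEq O]
    (V a : I × O → I × O → ℂ) (α d : ℂ)
    (ha : ∀ i i', ∑ o, a (i, o) (i', o) = if i = i' then α else 0) :
    pair a (fun k l => if k.2 = l.2 then (∑ x, V (k.1, x) (l.1, x)) / d else 0) =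
      α / d * ∑ k, V k k := by
  simp only [pair, Fintype.sum_prod_type, mul_ite, mul_zero, Finset.sum_ite_eq, Finset.mem_univ,
    if_true]
  rw [Finset.mul_sum]
  refine Finset.sum_congr rfl fun i _ => ?_
  rw [Finset.sum_comm]
  simp only [← Finset.sum_mul, ha, ite_mul, zero_mul, Finset.sum_ite_eq, Finset.mem_univ, if_true]
  ring

variable [DecidableEq AI] [DecidableEq AO] [DecidableEq BI] [DecidableEq BO]

theorem contractBoth_replAO (W : ProcOp AI AO BI BO) (a : AI × AO → AI × AO → ℂ)
    (b : BI × BO → BI × BO → ℂ) (α : ℂ)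
    (ha : ∀ i i', ∑ o, a (i, o) (i', o) = if i = i' then α else 0) :
    contractBoth (replAO W) a b = α / Fintype.card AO * contractBob W b := by
  have h : ∀ k₂ l₂, (pair a fun k₁ l₁ => replAO W (k₁, k₂) (l₁, l₂)) =
      α / Fintype.card AO * ∑ k₁, W (k₁, k₂) (k₁, l₂) := fun k₂ l₂ =>
    pair_replace (fun k l => W (k, k₂) (l, l₂)) a α _ ha
  simp only [contractBoth, contractBob, h]
  simp only [pair, Finset.mul_sum]
  refine Finset.sum_congr rfl fun _ _ => Finset.sum_congr rfl fun _ _ =>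
    Finset.sum_congr rfl fun _ _ => by ring

theorem contractBob_replBO (W : ProcOp AI AO BI BO) (b : BI × BO → BI × BO → ℂ) (β : ℂ)
    (hb : ∀ i i', ∑ o, b (i, o) (i', o) = if i = i' then β else 0) :
    contractBob (replBO W) b = β / Fintype.card BO * W.trace := by
  have h := pair_replace (fun k₂ l₂ => ∑ k₁, W (k₁, k₂) (k₁, l₂)) b β (Fintype.card BO) hb
  rw [Finset.sum_comm, ← Fintype.sum_prod_type (fun k => W k k)] at h
  refine Eq.trans ?_ h
  simp only [contractBob, replBO, Matrix.of_apply]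
  congr 1
  ext k l
  split_ifs
  · rw [← Finset.sum_div, Finset.sum_comm]
  · simp

theorem contractBob_replAI [Nonempty AI] (W : ProcOp AI AO BI BO) (b : BI × BO → BI × BO → ℂ) :
    contractBob (replAI W) b = contractBob W b := by
  simp only [contractBob, replAI, Matrix.of_apply, if_true]
  congr 1
  ext k l
  simp only [Fintype.sum_prod_type, Finset.sum_const, Finset.card_univ, nsmul_eq_mul,
    ← Finset.sum_div]
  rw [mul_div_cancel_left₀ _ (by simp), Finset.sum_comm]

theorem contractBob_replAO [Nonempty AO] (W : ProcOp AI AO BI BO) (b : BI × BO → BI × BO → ℂ) :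
    contractBob (replAO W) b = contractBob W b := by
  simp only [contractBob, replAO, Matrix.of_apply, if_true]
  congr 1
  ext k l
  simp only [Fintype.sum_prod_type, Finset.sum_const, Finset.card_univ, nsmul_eq_mul]
  refine Finset.sum_congr rfl fun i _ => ?_
  rw [mul_div_cancel₀ _ (by simp)]

theorem trace_eq_contractBob (W : ProcOp AI AO BI BO) :
    W.trace = contractBob W fun k l => if k = l then 1 else 0 := by
  rw [contractBob, pair_delta, Finset.sum_comm]
  exact Fintype.sum_prod_type fun k => W k k

variable [Nonempty AI] [Nonempty AO] [Nonempty BI] [Nonempty BO]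

/-- Tracing out Alice makes replacements on her systems invisible, so `marginalB` allows a free
replacement on `B_O`. After it only the trace of `W` matters. -/
theorem IsProcessMatrix.contractBob {W : ProcOp AI AO BI BO} (hW : IsProcessMatrix W)
    (b : BI × BO → BI × BO → ℂ) (β : ℂ)
    (hb : ∀ i i', ∑ o, b (i, o) (i', o) = if i = i' then β else 0) :
    contractBob W b = β * Fintype.card AO := by
  rw [← contractBob_replAO, ← contractBob_replAI, hW.marginalB, contractBob_replBO _ _ _ hb,
    trace_eq_contractBob, contractBob_replAI, contractBob_replAO, ← trace_eq_contractBob,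
    hW.trace_eq]
  have : (Fintype.card BO : ℂ) ≠ 0 := by simp
  field_simp

theorem IsProcessMatrix.contractBoth_replAO {W : ProcOp AI AO BI BO} (hW : IsProcessMatrix W)
    (a : AI × AO → AI × AO → ℂ) (b : BI × BO → BI × BO → ℂ) (α β : ℂ)
    (ha : ∀ i i', ∑ o, a (i, o) (i', o) = if i = i' then α else 0)
    (hb : ∀ i i', ∑ o, b (i, o) (i', o) = if i = i' then β else 0) :
    contractBoth (replAO W) a b = α * β := by
  rw [CausalComm.contractBoth_replAO W a b α ha, hW.contractBob b β hb]
  have : (Fintype.card AO : ℂ) ≠ 0 := by simp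
  field_simp

/-- Each of the three terms of `no_loops` contracts to `α * β`, with signs `+, +, -`. The scalars
`α`, `β` are arbitrary so that off-diagonal ancilla blocks of a channel, whose partial trace is
zero, are covered as well. -/
theorem IsProcessMatrix.contractBoth_eq {W : ProcOp AI AO BI BO} (hW : IsProcessMatrix W)
    (a : AI × AO → AI × AO → ℂ) (b : BI × BO → BI × BO → ℂ) (α β : ℂ)
    (ha : ∀ i i', ∑ o, a (i, o) (i', o) = if i = i' then α else 0)
    (hb : ∀ i i', ∑ o, b (i, o) (i', o) = if i = i' then β else 0) :
    contractBoth W a b = α * β := by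
  have h1 := hW.contractBoth_replAO a b α β ha hb
  have h2 : contractBoth (replBO W) a b = β * α := by
    rw [← hW.swap.contractBoth_replAO b a β α hb ha]
    exact pair_comm b a fun k₂ l₂ k₁ l₁ => replBO W (k₁, k₂) (l₁, l₂)
  have h3 : contractBoth (replAO (replBO W)) a b = α * β := by
    rw [CausalComm.contractBoth_replAO _ a b α ha, contractBob_replBO _ _ _ hb, hW.trace_eq]
    have : (Fintype.card AO : ℂ) ≠ 0 := by simp
    have : (Fintype.card BO : ℂ) ≠ 0 := by simp
    field_simp
  have h4 : contractBoth W a b = contractBoth (replAO W) a b + contractBoth (replBO W) a b -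
      contractBoth (replAO (replBO W)) a b := by
    conv_lhs => rw [hW.no_loops]
    simp only [contractBoth, pair, Matrix.add_apply, Matrix.sub_apply, mul_add, mul_sub,
      Finset.sum_add_distrib, Finset.sum_sub_distrib]
  rw [h4, h1, h2, h3]
  ring

end ProcessMatrices

/-! ### Local operations and no-signalling -/

section LocalOperations

variable {AI AO BI BO : Type*} [Fintype AI] [Fintype AO] [Fintype BI] [Fintype BO]
variable {AI' AO' BI' BO' : Type*}

theorem useProcess_apply (W : ProcOp AI AO BI BO)
    (A : Matrix ((AO × AO') × (AI × AI')) ((AO × AO') × (AI × AI')) ℂ)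
    (B : Matrix ((BO × BO') × (BI × BI')) ((BO × BO') × (BI × BI')) ℂ)
    (u v : (AO' × BO') × (AI' × BI')) :
    useProcess W A B u v = contractBoth W
      (fun k l => A ((k.2, u.1.1), (k.1, u.2.1)) ((l.2, v.1.1), (l.1, v.2.1)))
      (fun k l => B ((k.2, u.1.2), (k.1, u.2.2)) ((l.2, v.1.2), (l.1, v.2.2))) := by
  simp only [useProcess, Matrix.of_apply, contractBoth, pair, Finset.mul_sum]
  rw [Fintype.sum_prod_type, Finset.sum_comm]
  refine Finset.sum_congr rfl fun k₂ _ => ?_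
  rw [Finset.sum_comm, Fintype.sum_prod_type, Finset.sum_comm]
  refine Finset.sum_congr rfl fun l₂ _ => ?_
  rw [Finset.sum_comm]
  refine Finset.sum_congr rfl fun k₁ _ => Finset.sum_congr rfl fun l₁ _ => by ring

theorem useProcess_swapParties (W : ProcOp AI AO BI BO)
    (A : Matrix ((AO × AO') × (AI × AI')) ((AO × AO') × (AI × AI')) ℂ)
    (B : Matrix ((BO × BO') × (BI × BI')) ((BO × BO') × (BI × BI')) ℂ)
    (u v : (AO' × BO') × (AI' × BI')) :
    useProcess (swapParties W) B A (u.1.swap, u.2.swap) (v.1.swap, v.2.swap) =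
      useProcess W A B u v := by
  simp only [useProcess_apply]
  exact pair_comm _ _ fun k₁ l₁ k₂ l₂ => W (k₁, k₂) (l₁, l₂)

theorem useProcess_linear (W₁ W₂ : ProcOp AI AO BI BO) (c d : ℂ)
    (A : Matrix ((AO × AO') × (AI × AI')) ((AO × AO') × (AI × AI')) ℂ)
    (B : Matrix ((BO × BO') × (BI × BI')) ((BO × BO') × (BI × BI')) ℂ) :
    useProcess (c • W₁ + d • W₂) A B = c • useProcess W₁ A B + d • useProcess W₂ A B := by
  ext u v
  simp only [useProcess, Matrix.of_apply, Matrix.add_apply, Matrix.smul_apply, smul_eq_mul,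
    Finset.mul_sum, ← Finset.sum_add_distrib]
  refine Finset.sum_congr rfl fun _ _ => Finset.sum_congr rfl fun _ _ => by ring

theorem IsChannel.sum_eq {Y X : Type*} [Fintype Y] [DecidableEq X]
    {M : Matrix (Y × X) (Y × X) ℂ} (hM : IsChannel M) (x x' : X) :
    ∑ y, M (y, x) (y, x') = if x = x' then 1 else 0 := by
  have h := congrFun (congrFun hM.traceOut_eq x) x'
  rwa [Matrix.one_apply] at h

variable [DecidableEq AI] [DecidableEq BI] [DecidableEq AI'] [DecidableEq BI'] [Fintype BO']

theorem sum_contractBoth (W : ProcOp AI AO BI BO) {ι : Type*} [Fintype ι]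
    (a : AI × AO → AI × AO → ℂ) (b : ι → BI × BO → BI × BO → ℂ) :
    ∑ i, contractBoth W a (b i) = contractBoth W a fun k l => ∑ i, b i k l :=
  sum_pair_left _ b _

/-- The map from both inputs to the output of Bob is trace preserving. -/
theorem IsProcessMatrix.sum_useProcess [DecidableEq AO] [DecidableEq BO] [Nonempty AI] [Nonempty AO]
    [Nonempty BI] [Nonempty BO] {W : ProcOp AI AO BI BO} (hW : IsProcessMatrix W)
    {A : Matrix ((AO × Unit) × (AI × AI')) ((AO × Unit) × (AI × AI')) ℂ}
    {B : Matrix ((BO × BO') × (BI × BI')) ((BO × BO') × (BI × BI')) ℂ}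
    (hA : IsChannel A) (hB : IsChannel B) (x x' : AI') (y y' : BI') :
    ∑ z, useProcess W A B (((), z), (x, y)) (((), z), (x', y')) =
      (if x = x' then 1 else 0) * (if y = y' then 1 else 0) := by
  simp only [useProcess_apply, sum_contractBoth]
  refine hW.contractBoth_eq _ _ _ _ (fun i i' => ?_) (fun i i' => ?_)
  · have h := hA.sum_eq (i, x) (i', x')
    simp only [Fintype.sum_prod_type, Finset.univ_unique, Finset.sum_singleton, Prod.mk.injEq,
      ite_and] at h
    exact h
  · have h := hB.sum_eq (i, y) (i', y')
    simp only [Fintype.sum_prod_type, Prod.mk.injEq, ite_and] at h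
    exact h

/-- Feeding a state into the ancilla of a local operation of Alice. -/
def feedAncilla [Fintype AI'] (A : Matrix ((AO × Unit) × (AI × AI')) ((AO × Unit) × (AI × AI')) ℂ)
    (ρ : Matrix AI' AI' ℂ) : Matrix ((AO × Unit) × (AI × Unit)) ((AO × Unit) × (AI × Unit)) ℂ :=
  Matrix.of fun u v => pair (fun x x' => ρ x x') fun x x' => A (u.1, (u.2.1, x)) (v.1, (v.2.1, x'))

theorem isChannel_feedAncilla [Fintype AI']
    {A : Matrix ((AO × Unit) × (AI × AI')) ((AO × Unit) × (AI × AI')) ℂ} (hA : IsChannel A)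
    {ρ : Matrix AI' AI' ℂ} (hρ : IsState ρ) : IsChannel (feedAncilla A ρ) where
  posSemidef := by
    have h1 := hρ.posSemidef.submatrix
      (fun q : AI' × ((AO × Unit) × (AI × Unit)) => q.1)
    have h2 := hA.posSemidef.submatrix
      (fun q : AI' × ((AO × Unit) × (AI × Unit)) => (q.2.1, (q.2.2.1, q.1)))
    have h := posSemidef_pair h1 h2
    simp only [Matrix.submatrix_apply] at h
    exact h
  traceOut_eq := by
    ext ⟨i, _⟩ ⟨i', _⟩
    simp only [traceOut, feedAncilla, Matrix.of_apply, sum_pair, hA.sum_eq, Prod.mk.injEq,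
      Matrix.one_apply, and_true]
    by_cases hi : i = i'
    · simp only [hi, true_and, if_true, pair_ite, mul_one]
      exact hρ.trace_eq
    · simp [hi, pair_zero]

theorem useProcess_feedAncilla [Fintype AI'] (W : ProcOp AI AO BI BO)
    (A : Matrix ((AO × Unit) × (AI × AI')) ((AO × Unit) × (AI × AI')) ℂ)
    (B : Matrix ((BO × BO') × (BI × BI')) ((BO × BO') × (BI × BI')) ℂ)
    (ρ : Matrix AI' AI' ℂ) (z z' : BO') (y y' : BI') :
    useProcess W (feedAncilla A ρ) B (((), z), ((), y)) (((), z'), ((), y')) =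
      pair (fun x x' => ρ x x')
        fun x x' => useProcess W A B (((), z), (x, y)) (((), z'), (x', y')) := by
  simp only [useProcess_apply, contractBoth, feedAncilla, Matrix.of_apply, pair_pair_left]
  exact pair_comm _ _ _

/-- If Alice cannot signal to Bob, then Bob's output does not depend on Alice's ancilla. -/
theorem NoSignalAtoB.exists_eq [DecidableEq AO] [DecidableEq BO] [Nonempty AI] [Nonempty AO]
    [Nonempty BI] [Nonempty BO] {W : ProcOp AI AO BI BO} (hW : IsProcessMatrix W)
    (h : NoSignalAtoB W) {a b c : ℕ} (ha : Nonempty (Fin a))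
    {A : Matrix ((AO × Unit) × (AI × Fin a)) ((AO × Unit) × (AI × Fin a)) ℂ}
    {B : Matrix ((BO × Fin c) × (BI × Fin b)) ((BO × Fin c) × (BI × Fin b)) ℂ}
    (hA : IsChannel A) (hB : IsChannel B) :
    ∃ M : Matrix (Fin c × Fin b) (Fin c × Fin b) ℂ, IsChannel M ∧ ∀ z z' x x' y y',
      useProcess W A B (((), z), (x, y)) (((), z'), (x', y')) =
        if x = x' then M (z, y) (z', y') else 0 := by
  obtain ⟨x₀⟩ := ha
  have key : ∀ z z' x x' y y', useProcess W A B (((), z), (x, y)) (((), z'), (x', y')) =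
      if x = x' then useProcess W A B (((), z), (x₀, y)) (((), z'), (x₀, y')) else 0 := by
    intro z z' x x' y y'
    let ρ₀ : Matrix (Fin a) (Fin a) ℂ := Matrix.vecMulVec (Pi.single x₀ 1) (star (Pi.single x₀ 1))
    have hρ₀ : IsState ρ₀ := ⟨Matrix.posSemidef_vecMulVec_self_star _, by
      simp [ρ₀, Matrix.trace, Matrix.vecMulVec_apply, Pi.single_apply]⟩
    -- A state fed into Alice's ancilla turns her operation into a channel with trivial ancilla, of
    -- the kind the no-signalling condition compares. Any two states then give equal results, and
    -- the result with `ρ₀` is the reference value.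
    have hconst := eq_delta_of_constant_on_states
      (fun x x' => useProcess W A B (((), z), (x, y)) (((), z'), (x', y'))) _
      (fun ρ hρ => by
        rw [← useProcess_feedAncilla,
          ← useProcess_swapParties _ _ _ (((), z), ((), y)) (((), z'), ((), y')),
          h b c B _ _ hB (isChannel_feedAncilla hA hρ) (isChannel_feedAncilla hA hρ₀)])
    rw [hconst x x', hconst x₀ x₀, if_pos rfl]
  refine ⟨(useProcess W A B).submatrix (fun u => (((), u.1), (x₀, u.2)))
    (fun u => (((), u.1), (x₀, u.2))),
    ⟨(posSemidef_useProcess hW.posSemidef hA.posSemidef hB.posSemidef).submatrix _, ?_⟩,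
    fun z z' x x' y y' => key z z' x x' y y'⟩
  ext y y'
  have := hW.sum_useProcess hA hB x₀ x₀ y y'
  simpa [traceOut, Matrix.one_apply] using this

end LocalOperations

/-! ### Symmetric extensions -/

section Extension

/-- `K` is a symmetric extension of `N`: a pair of receivers, each of whom gets the channel `N`. -/
structure IsExtension {X Y Z : Type*} [Fintype Z] [DecidableEq X] [DecidableEq Y]
    (N : Matrix (Z × (X × Y)) (Z × (X × Y)) ℂ)
    (K : Matrix ((Z × Z) × (X × (Y × Y))) ((Z × Z) × (X × (Y × Y))) ℂ) : Prop where
  posSemidef : K.PosSemidef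
  sum_eq : ∀ x x' y y', ∑ z, N (z, (x, y)) (z, (x', y')) =
    if x = x' then if y = y' then 1 else 0 else 0
  sum_right : ∀ z z' x x' y y' w w', ∑ t, K ((z, t), (x, (y, w))) ((z', t), (x', (y', w'))) =
    if w = w' then N (z, (x, y)) (z', (x', y')) else 0
  sum_left : ∀ z z' x x' y y' w w', ∑ t, K ((t, z), (x, (w, y))) ((t, z'), (x', (w', y'))) =
    if w = w' then N (z, (x, y)) (z', (x', y')) else 0

/-- An equal mixture of a channel and a constant channel has a symmetric extension. -/
theorem isExtension_mixture {X Y Z : Type*} [Fintype Z] [DecidableEq Y] [DecidableEq X]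
    [Fintype X]
    {N : Matrix (Z × (X × Y)) (Z × (X × Y)) ℂ} {M : Matrix (Z × Y) (Z × Y) ℂ}
    (hN : IsChannel N) (hM : IsChannel M) :
    IsExtension (Matrix.of fun u v => (1 / 2 : ℂ) * N u v +
        (1 / 2) * if u.2.1 = v.2.1 then M (u.1, u.2.2) (v.1, v.2.2) else 0)
      (Matrix.of fun u v =>
        (1 / 2) * (N (u.1.1, (u.2.1, u.2.2.1)) (v.1.1, (v.2.1, v.2.2.1)) *
          M (u.1.2, u.2.2.2) (v.1.2, v.2.2.2)) +
        (1 / 2) * (N (u.1.2, (u.2.1, u.2.2.2)) (v.1.2, (v.2.1, v.2.2.2)) *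
          M (u.1.1, u.2.2.1) (v.1.1, v.2.2.1))) where
  posSemidef := by
    have hc : (0 : ℂ) ≤ 1 / 2 := by
      rw [show (1 / 2 : ℂ) = ((1 / 2 : ℝ) : ℂ) by norm_num]
      exact Complex.zero_le_real.2 (by norm_num)
    have h1 := (posSemidef_mul (hN.posSemidef.submatrix
      fun u : (Z × Z) × (X × (Y × Y)) => (u.1.1, (u.2.1, u.2.2.1)))
      (hM.posSemidef.submatrix fun u : (Z × Z) × (X × (Y × Y)) => (u.1.2, u.2.2.2))).smul hc
    have h2 := (posSemidef_mul (hN.posSemidef.submatrix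
      fun u : (Z × Z) × (X × (Y × Y)) => (u.1.2, (u.2.1, u.2.2.2)))
      (hM.posSemidef.submatrix fun u : (Z × Z) × (X × (Y × Y)) => (u.1.1, u.2.2.1))).smul hc
    exact h1.add h2
  sum_eq := by
    intro x x' y y'
    simp only [Matrix.of_apply, Finset.sum_add_distrib, ← Finset.mul_sum, hN.sum_eq,
      Prod.mk.injEq]
    by_cases hx : x = x'
    · simp only [hx, true_and, if_true, hM.sum_eq]
      split_ifs <;> norm_num
    · simp [hx]
  -- Discarding the second output removes `M` from the first summand and leaves `N`. In the second
  -- summand it removes `N`, whose trace preservation also yields the `x = x'` factor of the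
  -- constant channel.
  sum_right := by
    intro z z' x x' y y' w w'
    simp only [Matrix.of_apply, Finset.sum_add_distrib, ← Finset.mul_sum, ← Finset.sum_mul,
      hN.sum_eq, hM.sum_eq, Prod.mk.injEq]
    split_ifs <;> simp_all
  sum_left := by
    intro z z' x x' y y' w w'
    simp only [Matrix.of_apply, Finset.sum_add_distrib, ← Finset.mul_sum, ← Finset.sum_mul,
      hN.sum_eq, hM.sum_eq, Prod.mk.injEq]
    split_ifs <;> simp_all [add_comm]

/-- Sums over tuples of outputs factor over the uses, and the product of the coordinatewise deltas
is the delta of the tuples. -/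
theorem isExtension_prod {ι : Type*} [Fintype ι] [DecidableEq ι] {X Y Z : ι → Type*}
    [∀ i, Fintype (Z i)] [∀ i, DecidableEq (X i)] [∀ i, DecidableEq (Y i)]
    {N : ∀ i, Matrix (Z i × (X i × Y i)) (Z i × (X i × Y i)) ℂ}
    {K : ∀ i, Matrix ((Z i × Z i) × (X i × (Y i × Y i))) ((Z i × Z i) × (X i × (Y i × Y i))) ℂ}
    (h : ∀ i, IsExtension (N i) (K i)) :
    IsExtension (X := ∀ i, X i) (Y := ∀ i, Y i) (Z := ∀ i, Z i)
      (Matrix.of fun u v => ∏ i, N i (u.1 i, (u.2.1 i, u.2.2 i)) (v.1 i, (v.2.1 i, v.2.2 i)))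
      (Matrix.of fun u v => ∏ i, K i ((u.1.1 i, u.1.2 i), (u.2.1 i, (u.2.2.1 i, u.2.2.2 i)))
        ((v.1.1 i, v.1.2 i), (v.2.1 i, (v.2.2.1 i, v.2.2.2 i)))) where
  posSemidef := posSemidef_prod fun i => (h i).posSemidef.submatrix
    fun u : ((∀ i, Z i) × (∀ i, Z i)) × ((∀ i, X i) × ((∀ i, Y i) × (∀ i, Y i))) =>
      ((u.1.1 i, u.1.2 i), (u.2.1 i, (u.2.2.1 i, u.2.2.2 i)))
  sum_eq := by
    intro x x' y y'
    simp only [Matrix.of_apply]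
    rw [← Fintype.prod_sum fun i z => N i (z, (x i, y i)) (z, (x' i, y' i))]
    simp only [(h _).sum_eq, Finset.prod_ite_zero, funext_iff, Finset.mem_univ, true_imp_iff,
      Finset.prod_const_one]
  sum_right := by
    intro z z' x x' y y' w w'
    simp only [Matrix.of_apply]
    rw [← Fintype.prod_sum fun i t => K i ((z i, t), (x i, (y i, w i)))
      ((z' i, t), (x' i, (y' i, w' i)))]
    simp only [(h _).sum_right, Finset.prod_ite_zero, funext_iff, Finset.mem_univ, true_imp_iff]
  sum_left := by
    intro z z' x x' y y' w w'
    simp only [Matrix.of_apply]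
    rw [← Fintype.prod_sum fun i t => K i ((t, z i), (x i, (w i, y i)))
      ((t, z' i), (x' i, (w' i, y' i)))]
    simp only [(h _).sum_left, Finset.prod_ite_zero, funext_iff, Finset.mem_univ, true_imp_iff]

/-! ### Encoding and decoding with one or two receivers -/

variable {U V X Y Z : Type*} [Fintype U] [Fintype V] [Fintype X] [Fintype Y] [Fintype Z]

/-- Encoding, use of the channel `N` with the help of a state `EB`, and decoding. -/
def transmit (EA : Matrix (X × U) (X × U) ℂ) (EB : Matrix Y Y ℂ) (DB : Matrix (V × Z) (V × Z) ℂ)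
    (N : Matrix (Z × (X × Y)) (Z × (X × Y)) ℂ) : Matrix (V × U) (V × U) ℂ :=
  Matrix.of fun u v => pair (fun x x' => EA (x, u.2) (x', v.2)) fun x x' =>
    pair (fun y y' => EB y y') fun y y' =>
    pair (fun z z' => DB (u.1, z) (v.1, z')) fun z z' => N (z, (x, y)) (z', (x', y'))

/-- The same with two receivers. -/
def transmitTwo (EA : Matrix (X × U) (X × U) ℂ) (EB : Matrix Y Y ℂ)
    (DB : Matrix (V × Z) (V × Z) ℂ)
    (K : Matrix ((Z × Z) × (X × (Y × Y))) ((Z × Z) × (X × (Y × Y))) ℂ) :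
    Matrix ((V × V) × U) ((V × V) × U) ℂ :=
  Matrix.of fun u v => pair (fun x x' => EA (x, u.2) (x', v.2)) fun x x' =>
    pair (fun y y' => EB y y') fun y y' => pair (fun y y' => EB y y') fun w w' =>
    pair (fun z z' => DB (u.1.1, z) (v.1.1, z')) fun z z' =>
    pair (fun t t' => DB (u.1.2, t) (v.1.2, t')) fun t t' =>
      K ((z, t), (x, (y, w))) ((z', t'), (x', (y', w')))

variable [DecidableEq U] [DecidableEq X] [DecidableEq Y] [DecidableEq Z]
  {EA : Matrix (X × U) (X × U) ℂ} {EB : Matrix Y Y ℂ} {DB : Matrix (V × Z) (V × Z) ℂ}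
  {N : Matrix (Z × (X × Y)) (Z × (X × Y)) ℂ}
  {K : Matrix ((Z × Z) × (X × (Y × Y))) ((Z × Z) × (X × (Y × Y))) ℂ}

theorem posSemidef_transmitTwo (hEA : EA.PosSemidef) (hEB : EB.PosSemidef) (hDB : DB.PosSemidef)
    (hK : K.PosSemidef) : (transmitTwo EA EB DB K).PosSemidef := by
  let R := (V × V) × U
  have h1 := hK.submatrix fun q : Z × Z × Y × Y × X × R =>
    ((q.2.1, q.1), (q.2.2.2.2.1, (q.2.2.2.1, q.2.2.1)))
  have h2 := posSemidef_pair (hDB.submatrix fun q : Z × Z × Y × Y × X × R =>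
    (q.2.2.2.2.2.1.2, q.1)) h1
  have h3 := posSemidef_pair (hDB.submatrix fun q : Z × Y × Y × X × R =>
    (q.2.2.2.2.1.1, q.1)) h2
  have h4 := posSemidef_pair (hEB.submatrix fun q : Y × Y × X × R => q.1) h3
  have h5 := posSemidef_pair (hEB.submatrix fun q : Y × X × R => q.1) h4
  have h6 := posSemidef_pair (hEA.submatrix fun q : X × R => (q.1, q.2.2)) h5
  simp only [Matrix.submatrix_apply, Matrix.of_apply] at h6
  exact h6

/-- Trace preservation erases the second decoder, which leaves the trace over the second output of
`K`; the extension property then frees the second ancilla, and its state contributes trace one. -/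
theorem sum_transmitTwo_right (hEB : IsState EB) (hDB : IsChannel DB) (hK : IsExtension N K)
    (v v' : V) (u u' : U) :
    ∑ w, transmitTwo EA EB DB K ((v, w), u) ((v', w), u') =
      transmit EA EB DB N (v, u) (v', u') := by
  have htr : ∑ y, EB y y = 1 := hEB.trace_eq
  simp only [transmitTwo, transmit, Matrix.of_apply, sum_pair, sum_pair_left, hDB.sum_eq,
    pair_delta, hK.sum_right, pair_ite_zero, pair_ite, htr, one_mul]

theorem transmitTwo_swap (v v' w w' : V) (u u' : U) :
    transmitTwo EA EB DB K ((v, w), u) ((v', w'), u') =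
      transmitTwo EA EB DB (K.submatrix (Prod.map Prod.swap (Prod.map id Prod.swap))
        (Prod.map Prod.swap (Prod.map id Prod.swap))) ((w, v), u) ((w', v'), u') := by
  simp only [transmitTwo, Matrix.of_apply, Matrix.submatrix_apply, Prod.map, Prod.swap, id]
  congr 1
  ext x x'
  refine (pair_comm _ _ _).trans ?_
  congr 1
  ext y y'
  congr 1
  ext z z'
  exact pair_comm _ _ _

theorem IsExtension.swap (hK : IsExtension N K) :
    IsExtension N (K.submatrix (Prod.map Prod.swap (Prod.map id Prod.swap))
        (Prod.map Prod.swap (Prod.map id Prod.swap))) where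
  posSemidef := hK.posSemidef.submatrix _
  sum_eq := hK.sum_eq
  sum_right := hK.sum_left
  sum_left := hK.sum_right

theorem sum_transmitTwo_left (hEB : IsState EB) (hDB : IsChannel DB) (hK : IsExtension N K)
    (v v' : V) (u u' : U) :
    ∑ w, transmitTwo EA EB DB K ((w, v), u) ((w, v'), u') =
      transmit EA EB DB N (v, u) (v', u') := by
  simp only [transmitTwo_swap (K := K)]
  exact sum_transmitTwo_right hEB hDB hK.swap v v' u u'

theorem sum_transmit (hEA : IsChannel EA) (hEB : IsState EB) (hDB : IsChannel DB)
    (hK : IsExtension N K) (u u' : U) :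
    ∑ v, transmit EA EB DB N (v, u) (v, u') = if u = u' then 1 else 0 := by
  have htr : ∑ y, EB y y = 1 := hEB.trace_eq
  simp only [transmit, Matrix.of_apply, sum_pair, sum_pair_left, hDB.sum_eq, pair_delta, hK.sum_eq,
    pair_ite_zero, pair_ite, htr, mul_one, hEA.sum_eq]

/-- Positivity is inherited as a marginal of the two-receiver map, since `IsExtension` does not
record positivity of `N` itself. -/
theorem posSemidef_transmit (hEA : EA.PosSemidef) (hEB : IsState EB) (hDB : IsChannel DB)
    (hK : IsExtension N K) : (transmit EA EB DB N).PosSemidef := by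
  have h := Matrix.posSemidef_sum Finset.univ fun (w : V) _ =>
    (posSemidef_transmitTwo hEA hEB.posSemidef hDB.posSemidef hK.posSemidef).submatrix
      fun q : V × U => ((q.1, w), q.2)
  convert h using 1
  ext ⟨v, u⟩ ⟨v', u'⟩
  rw [Matrix.sum_apply]
  exact (sum_transmitTwo_right hEB hDB hK v v' u u').symm

end Extension

/-! ### Fidelity with a pure state -/

section Fidelity

variable {X : Type*} [Fintype X] [DecidableEq X]

theorem cfc_sqrt_mul_self {a : Matrix X X ℂ} (ha : a.PosSemidef) :
    cfc Real.sqrt (a * a) = a := by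
  have hsa : IsSelfAdjoint a := ha.1
  have hspec : ∀ x ∈ spectrum ℝ a, 0 ≤ x := fun x hx => Complex.zero_le_real.1
    ((Matrix.posSemidef_iff_isHermitian_and_spectrum_nonneg.1 ha).2 (spectrum.algebraMap_mem ℂ hx))
  have h1 : a * a = cfc (fun x : ℝ => x ^ 2) a := by
    rw [cfc_pow_id (R := ℝ) a 2, sq]
  rw [h1, ← cfc_comp Real.sqrt (fun x : ℝ => x ^ 2) a]
  conv_rhs => rw [← cfc_id ℝ a]
  exact cfc_congr fun x hx => Real.sqrt_sq (hspec x hx)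

/-- The fidelity of a pure state with an arbitrary operator. -/
theorem fidelity_vecMulVec (ψ : X → ℂ) (hψ : star ψ ⬝ᵥ ψ = 1) (ρ : Matrix X X ℂ)
    (hρ : 0 ≤ star ψ ⬝ᵥ (ρ *ᵥ ψ)) :
    fidelity (Matrix.vecMulVec ψ (star ψ)) ρ = (star ψ ⬝ᵥ (ρ *ᵥ ψ)).re := by
  set σ := Matrix.vecMulVec ψ (star ψ) with hσ
  set c := star ψ ⬝ᵥ (ρ *ᵥ ψ) with hc
  have hpos : σ.PosSemidef := Matrix.posSemidef_vecMulVec_self_star ψ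
  have hσσ : σ * σ = σ := by
    rw [hσ, Matrix.vecMulVec_mul_vecMulVec, hψ]
    simp
  have hroot : cfc Real.sqrt σ = σ := by
    conv_lhs => rw [← hσσ]
    exact cfc_sqrt_mul_self hpos
  have hcre : ((Real.sqrt c.re : ℝ) : ℂ) * (Real.sqrt c.re : ℝ) = c := by
    rw [← Complex.ofReal_mul, Real.mul_self_sqrt (Complex.nonneg_iff.1 hρ).1]
    exact (Complex.eq_re_of_ofReal_le (r := 0) (by simpa using hρ)).symm
  -- Sandwiching by a rank-one projection leaves a multiple of it, whose square root is explicit.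
  have hsandwich : σ * ρ * σ = c • σ := by
    rw [hσ, Matrix.vecMulVec_mul, Matrix.vecMulVec_mul_vecMulVec, ← Matrix.dotProduct_mulVec, ← hc]
    ext i j
    simp [Matrix.vecMulVec_apply]
    ring
  have hr : (((Real.sqrt c.re : ℝ) : ℂ) • σ).PosSemidef :=
    hpos.smul (Complex.zero_le_real.2 (Real.sqrt_nonneg _))
  have hroot2 : cfc Real.sqrt (c • σ) = ((Real.sqrt c.re : ℝ) : ℂ) • σ := by
    rw [← cfc_sqrt_mul_self hr, smul_mul_smul_comm, hσσ, hcre]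
  have htr : σ.trace = 1 := by
    rw [hσ, Matrix.trace_vecMulVec, dotProduct_comm, hψ]
  rw [fidelity, hroot, hsandwich, hroot2, Matrix.trace_smul, htr, smul_eq_mul, mul_one,
    Complex.ofReal_re, Real.sq_sqrt (Complex.nonneg_iff.1 hρ).1]

end Fidelity

/-! ### A quantitative no-cloning bound -/

section NoCloning

variable {X Y : Type*} [Fintype X] [Fintype Y]

theorem pair_nonneg {D f : Matrix X X ℂ} (hD : D.PosSemidef) (hf : f.PosSemidef) :
    0 ≤ pair (fun x x' => D x x') fun x x' => f x x' := by
  have h := posSemidef_pair (hD.submatrix (Prod.fst : X × Unit → X))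
    (hf.submatrix (Prod.fst : X × Unit → X))
  exact h.diag_nonneg (i := ())

theorem pair_add_left (D D' f : X → X → ℂ) :
    pair (fun x x' => D x x' + D' x x') f = pair D f + pair D' f := by
  simp [pair, add_mul, Finset.sum_add_distrib]

theorem pair_sub_left (D D' f : X → X → ℂ) :
    pair (fun x x' => D x x' - D' x x') f = pair D f - pair D' f := by
  simp [pair, sub_mul, Finset.sum_sub_distrib]

/-- The action of the map with Choi matrix `M` on the pure state `φ`. -/
def applyPure (M : Matrix (Y × X) (Y × X) ℂ) (φ : X → ℂ) : Matrix Y Y ℂ :=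
  Matrix.of fun s t => pair (fun a a' => φ a * star (φ a')) fun a a' => M (s, a) (t, a')

/-- The expectation value of `ρ` in the pure state `φ`. -/
def expectation (ρ : Matrix X X ℂ) (φ : X → ℂ) : ℂ :=
  pair (fun u v => star (φ u) * φ v) fun u v => ρ u v

theorem posSemidef_applyPure {M : Matrix (Y × X) (Y × X) ℂ} (hM : M.PosSemidef) (φ : X → ℂ) :
    (applyPure M φ).PosSemidef := by
  have h := posSemidef_pair ((Matrix.posSemidef_vecMulVec_self_star φ).submatrix
    (fun q : X × Y => q.1)) (hM.submatrix fun q : X × Y => (q.2, q.1))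
  simp only [Matrix.submatrix_apply, Matrix.vecMulVec_apply] at h
  exact h

theorem expectation_nonneg {ρ : Matrix X X ℂ} (hρ : ρ.PosSemidef) (φ : X → ℂ) :
    0 ≤ expectation ρ φ := by
  have h := pair_nonneg (Matrix.posSemidef_vecMulVec_star_self φ) hρ
  simp only [Matrix.vecMulVec_apply] at h
  exact h

theorem expectation_eq_dotProduct (ρ : Matrix X X ℂ) (φ : X → ℂ) :
    expectation ρ φ = star φ ⬝ᵥ (ρ *ᵥ φ) := by
  simp only [expectation, pair, dotProduct, Matrix.mulVec, Finset.mul_sum]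
  refine Finset.sum_congr rfl fun _ _ => Finset.sum_congr rfl fun _ _ => by
    simp only [Pi.star_apply]
    ring

variable [DecidableEq X]

/-- The union bound: two events of large probability occur together with large probability. -/
theorem expectation_add_le {τ : Matrix (X × X) (X × X) ℂ} (hτ : τ.PosSemidef) (φ : X → ℂ)
    (hφ : ∑ a, φ a * star (φ a) = 1) :
    expectation (Matrix.of fun u v => ∑ w, τ (u, w) (v, w)) φ +
      expectation (Matrix.of fun u v => ∑ w, τ (w, u) (w, v)) φ ≤
      τ.trace + expectation τ fun s => φ s.1 * φ s.2 := by
  -- The complementary projection `Q` is positive, hence so is `Q ⊗ Q`, the event that both copies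
  -- fail. Expanding its nonnegative expectation in `τ` gives the union bound.
  have hQ : (1 - Matrix.vecMulVec (star φ) φ).PosSemidef := by
    have hP := (Matrix.posSemidef_vecMulVec_star_self φ).1
    have hPP : Matrix.vecMulVec (star φ) φ * Matrix.vecMulVec (star φ) φ =
        Matrix.vecMulVec (star φ) φ := by
      rw [Matrix.vecMulVec_mul_vecMulVec]
      have : φ ⬝ᵥ star φ = 1 := hφ
      simp [this]
    have h := Matrix.posSemidef_self_mul_conjTranspose (1 - Matrix.vecMulVec (star φ) φ)
    rwa [Matrix.conjTranspose_sub, Matrix.conjTranspose_one, hP.eq, sub_mul, one_mul, mul_sub,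
      mul_one, hPP, sub_self, sub_zero] at h
  have hQQ := posSemidef_mul (hQ.submatrix (Prod.fst : X × X → X))
    (hQ.submatrix (Prod.snd : X × X → X))
  have h := pair_nonneg hQQ hτ
  have hexp : (pair (fun s t => (Matrix.of fun u v : X × X =>
      (Matrix.submatrix (1 - Matrix.vecMulVec (star φ) φ) Prod.fst Prod.fst) u v *
      (Matrix.submatrix (1 - Matrix.vecMulVec (star φ) φ) Prod.snd Prod.snd) u v) s t)
      fun s t => τ s t) = τ.trace + (expectation τ fun s => φ s.1 * φ s.2) -
      expectation (Matrix.of fun u v => ∑ w, τ (u, w) (v, w)) φ -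
      expectation (Matrix.of fun u v => ∑ w, τ (w, u) (w, v)) φ := by
    have e : ∀ s t : X × X, (Matrix.of fun u v : X × X =>
      (Matrix.submatrix (1 - Matrix.vecMulVec (star φ) φ) Prod.fst Prod.fst) u v *
      (Matrix.submatrix (1 - Matrix.vecMulVec (star φ) φ) Prod.snd Prod.snd) u v) s t =
      (if s = t then 1 else 0) + star (φ s.1 * φ s.2) * (φ t.1 * φ t.2) -
        (star (φ s.1) * φ t.1) * (if s.2 = t.2 then 1 else 0) -
        (star (φ s.2) * φ t.2) * (if s.1 = t.1 then 1 else 0) := by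
      rintro ⟨s1, s2⟩ ⟨t1, t2⟩
      simp only [Matrix.of_apply, Matrix.submatrix_apply, Matrix.sub_apply, Matrix.one_apply,
        Matrix.vecMulVec_apply, Prod.mk.injEq, star_mul', Pi.star_apply]
      by_cases h1 : s1 = t1 <;> by_cases h2 : s2 = t2 <;> simp [h1, h2] <;> ring
    simp only [e, pair_sub_left, pair_add_left, pair_delta]
    congr 1
    · congr 1
      simp only [expectation, pair, Matrix.of_apply, Fintype.sum_prod_type]
      refine Finset.sum_congr rfl fun u _ => ?_
      rw [Finset.sum_comm]
      refine Finset.sum_congr rfl fun v _ => ?_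
      simp [Finset.mul_sum]
    · simp only [expectation, pair, Matrix.of_apply, Fintype.sum_prod_type]
      rw [Finset.sum_comm]
      refine Finset.sum_congr rfl fun u _ => ?_
      simp only [mul_ite, mul_one, mul_zero, ite_mul, zero_mul, Finset.mul_sum]
      conv_lhs =>
        enter [2, x]
        rw [Finset.sum_comm]
      rw [Finset.sum_comm]
      refine Finset.sum_congr rfl fun v _ => ?_
      simp
  rw [hexp] at h
  have h2 := add_le_add_left h (expectation (Matrix.of fun u v => ∑ w, τ (u, w) (v, w)) φ +
      expectation (Matrix.of fun u v => ∑ w, τ (w, u) (w, v)) φ)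
  convert h2 using 1 <;> ring

/-- The vector with coordinates `α`, `β` in the directions `i`, `j`. -/
def qubitVec (i j : X) (α β : ℂ) : X → ℂ := Pi.single i α + Pi.single j β

theorem sum_qubitVec (i j : X) (α β : ℂ) (f : X → ℂ) :
    ∑ a, qubitVec i j α β a * f a = α * f i + β * f j := by
  simp [qubitVec, Pi.single_apply, add_mul, Finset.sum_add_distrib]

theorem sum_star_qubitVec (i j : X) (α β : ℂ) (f : X → ℂ) :
    ∑ a, star (qubitVec i j α β a) * f a = star α * f i + star β * f j := by
  simp [qubitVec, Pi.single_apply, add_mul, Finset.sum_add_distrib, apply_ite (starRingEnd ℂ)]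

theorem qubitVec_norm {i j : X} (hij : i ≠ j) (α β : ℂ) :
    ∑ a, qubitVec i j α β a * star (qubitVec i j α β a) = α * star α + β * star β := by
  rw [sum_qubitVec]
  simp [qubitVec, hij, hij.symm]

theorem applyPure_qubitVec (M : Matrix (Y × X) (Y × X) ℂ) (i j : X) (α β : ℂ) (s t : Y) :
    applyPure M (qubitVec i j α β) s t =
      α * (star α * M (s, i) (t, i) + star β * M (s, i) (t, j)) +
      β * (star α * M (s, j) (t, i) + star β * M (s, j) (t, j)) := by
  simp only [applyPure, Matrix.of_apply, pair, mul_assoc, ← Finset.mul_sum, sum_qubitVec,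
    sum_star_qubitVec]

/-- The expectation value in two copies of a qubit state, in terms of the matrix elements. -/
def qubitForm (T : Matrix (X × X) (X × X) ℂ) (i j : X) (α β : ℂ) : ℂ :=
  let r : X → X → ℂ := fun k l => α * (α * T (k, l) (i, i) + β * T (k, l) (i, j)) +
    β * (α * T (k, l) (j, i) + β * T (k, l) (j, j))
  star α * (star α * r i i + star β * r i j) + star β * (star α * r j i + star β * r j j)

theorem expectation_qubitVec (T : Matrix (X × X) (X × X) ℂ) (i j : X) (α β : ℂ) :
    (expectation T fun s => qubitVec i j α β s.1 * qubitVec i j α β s.2) =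
      qubitForm T i j α β := by
  simp only [expectation, pair, Fintype.sum_prod_type, star_mul', mul_assoc, ← Finset.mul_sum,
    sum_qubitVec, sum_star_qubitVec, qubitForm]

theorem qubitForm_smul (T : Matrix (X × X) (X × X) ℂ) (i j : X) (α β s : ℂ) (hs : star s = s) :
    qubitForm T i j (s * α) (s * β) = s ^ 4 * qubitForm T i j α β := by
  simp only [qubitForm, star_mul', hs]
  ring

/-- Averaging over the three mutually unbiased qubit bases yields the identity plus the swap. -/
theorem qubitForm_sum (T : Matrix (X × X) (X × X) ℂ) (i j : X) :
    4 * qubitForm T i j 1 0 + 4 * qubitForm T i j 0 1 + qubitForm T i j 1 1 +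
      qubitForm T i j 1 (-1) + qubitForm T i j 1 Complex.I + qubitForm T i j 1 (-Complex.I) =
    8 * T (i, i) (i, i) + 8 * T (j, j) (j, j) + 4 * T (i, j) (i, j) + 4 * T (j, i) (j, i) +
      4 * T (i, j) (j, i) + 4 * T (j, i) (i, j) := by
  simp only [qubitForm, star_one, star_zero, star_neg, Complex.star_def, Complex.conj_I]
  ring_nf
  simp only [show Complex.I ^ 4 = 1 by simp, Complex.I_sq]
  ring

theorem pair_norm (φ : X → ℂ) :
    (pair (fun a a' => φ a * star (φ a')) fun a a' => if a = a' then 1 else 0) =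
      ∑ a, φ a * star (φ a) := by
  rw [pair_ite, mul_one]

theorem sum_applyPure {ι : Type*} [Fintype ι] (M : Matrix (Y × X) (Y × X) ℂ) (φ : X → ℂ)
    (f g : ι → Y) : ∑ w, applyPure M φ (f w) (g w) =
      pair (fun a a' => φ a * star (φ a')) fun a a' => ∑ w, M (f w, a) (g w, a') :=
  sum_pair _ _ _

/-- Two receivers cannot both obtain a good copy of every pure qubit state. -/
theorem no_cloning {i j : X} (hij : i ≠ j) {L : Matrix ((X × X) × X) ((X × X) × X) ℂ}
    (hL : L.PosSemidef) {Φ : Matrix (X × X) (X × X) ℂ}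
    (hright : ∀ v v' u u', ∑ w, L ((v, w), u) ((v', w), u') = Φ (v, u) (v', u'))
    (hleft : ∀ v v' u u', ∑ w, L ((w, v), u) ((w, v'), u') = Φ (v, u) (v', u'))
    (hΦ : ∀ u u', ∑ v, Φ (v, u) (v, u') = if u = u' then 1 else 0) {ε : ℝ}
    (hF : ∀ φ : X → ℂ, ∑ a, φ a * star (φ a) = 1 → 1 - ε ≤ (expectation (applyPure Φ φ) φ).re) :
    1 / 6 ≤ ε := by
  have htr : ∀ u u', ∑ s, L (s, u) (s, u') = if u = u' then 1 else 0 := by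
    intro u u'
    simp only [Fintype.sum_prod_type, hright, hΦ]
  have hboth : ∀ φ : X → ℂ, ∑ a, φ a * star (φ a) = 1 →
      1 - 2 * ε ≤ (expectation (applyPure L φ) fun s => φ s.1 * φ s.2).re := by
    intro φ hφ
    have h := expectation_add_le (posSemidef_applyPure hL φ) φ hφ
    have h1 : (Matrix.of fun u v => ∑ w, applyPure L φ (u, w) (v, w)) = applyPure Φ φ := by
      ext u v
      simp only [Matrix.of_apply, sum_applyPure L φ (fun w => (u, w)) (fun w => (v, w)), hright]
      rfl
    have h2 : (Matrix.of fun u v => ∑ w, applyPure L φ (w, u) (w, v)) = applyPure Φ φ := by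
      ext u v
      simp only [Matrix.of_apply, sum_applyPure L φ (fun w => (w, u)) (fun w => (w, v)), hleft]
      rfl
    have h3 : (applyPure L φ).trace = 1 := by
      have := sum_applyPure L φ (fun s => s) (fun s => s)
      simp only [htr, pair_norm, hφ] at this
      exact this
    rw [h1, h2, h3] at h
    have h4 := (Complex.le_def.1 h).1
    simp only [Complex.add_re, Complex.one_re] at h4
    linarith [hF φ hφ]
  -- `T` is the cloner's output on the unnormalized identity of the qubit spanned by `i` and `j`, so
  -- its trace is 2.
  let T : Matrix (X × X) (X × X) ℂ := Matrix.of fun s t => L (s, i) (t, i) + L (s, j) (t, j)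
  have hT : T.PosSemidef := (hL.submatrix fun s => (s, i)).add (hL.submatrix fun s => (s, j))
  have hTtr : ∑ s, T s s = 2 := by
    simp only [T, Matrix.of_apply, Finset.sum_add_distrib, htr, if_true]
    norm_num
  -- The vectors `(α, β)` and `(α', β')` resolve the qubit identity, so `T` is the sum of their two
  -- outputs. The second contributes a nonnegative expectation and is dropped.
  have hform : ∀ α β α' β' : ℂ, α * star α + β * star β = 1 →
      (∀ a b c d : ℂ, α * (star α * a + star β * b) + β * (star α * c + star β * d) +
        (α' * (star α' * a + star β' * b) + β' * (star α' * c + star β' * d)) = a + d) →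
      1 - 2 * ε ≤ (qubitForm T i j α β).re := by
    intro α β α' β' hn hsum
    have hTeq : ∀ s t, T s t = applyPure L (qubitVec i j α β) s t +
        applyPure L (qubitVec i j α' β') s t := by
      intro s t
      rw [applyPure_qubitVec, applyPure_qubitVec, hsum]
      rfl
    have h1 := hboth (qubitVec i j α β) (by rw [qubitVec_norm hij, hn])
    have h2 := expectation_nonneg (posSemidef_applyPure hL (qubitVec i j α' β'))
      fun s => qubitVec i j α β s.1 * qubitVec i j α β s.2
    have h3 : qubitForm T i j α β =
        (expectation (applyPure L (qubitVec i j α β))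
          fun s => qubitVec i j α β s.1 * qubitVec i j α β s.2) +
        expectation (applyPure L (qubitVec i j α' β'))
          fun s => qubitVec i j α β s.1 * qubitVec i j α β s.2 := by
      rw [← expectation_qubitVec]
      simp only [expectation, hTeq, pair, mul_add, Finset.sum_add_distrib]
    rw [h3, Complex.add_re]
    linarith [(Complex.nonneg_iff.1 h2).1]
  obtain ⟨s, hs, hs2⟩ : ∃ s : ℂ, star s = s ∧ s * s = 1 / 2 := by
    refine ⟨((1 / Real.sqrt 2 : ℝ) : ℂ), Complex.conj_ofReal _, ?_⟩
    rw [← Complex.ofReal_mul, div_mul_div_comm, Real.mul_self_sqrt (by norm_num)]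
    norm_num
  have hs4 : s ^ 4 = ((1 / 4 : ℝ) : ℂ) := by
    rw [show s ^ 4 = (s * s) * (s * s) by ring, hs2]
    norm_num
  have hω : ∀ ω : ℂ, ω * star ω = 1 → 4 * (1 - 2 * ε) ≤ (qubitForm T i j 1 ω).re := by
    intro ω hω
    have h := hform (s * 1) (s * ω) (s * 1) (s * -ω)
      (by
        simp only [star_mul', hs, star_one]
        linear_combination (1 + ω * star ω) * hs2 + 1 / 2 * hω)
      (fun a b c d => by
        simp only [star_mul', hs, star_one, star_neg]
        linear_combination (2 * a + 2 * ω * star ω * d) * hs2 + d * hω)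
    rw [qubitForm_smul _ _ _ _ _ _ hs, hs4, Complex.re_ofReal_mul] at h
    linarith
  have e1 := hform 1 0 0 1 (by simp) (fun a b c d => by simp)
  have e2 := hform 0 1 1 0 (by simp) (fun a b c d => by simp [add_comm])
  have e3 := hω 1 (by simp)
  have e4 := hω (-1) (by simp)
  have e5 := hω Complex.I (by simp)
  have e6 := hω (-Complex.I) (by simp)
  have hsum := congrArg Complex.re (qubitForm_sum T i j)
  have hc : ∀ z : ℂ, (4 * z).re = 4 * z.re := fun z => by simp
  have hc' : ∀ z : ℂ, (8 * z).re = 8 * z.re := fun z => by simp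
  simp only [Complex.add_re, hc, hc'] at hsum
  have hne : ((i, j) : X × X) ≠ (j, i) := fun h => hij (Prod.ext_iff.1 h).1
  -- Positivity of `T` on the antisymmetric vector `e_(i,j) - e_(j,i)` says that the swap terms do
  -- not exceed the diagonal ones.
  have hswap : (T (i, j) (j, i)).re + (T (j, i) (i, j)).re ≤
      (T (i, j) (i, j)).re + (T (j, i) (j, i)).re := by
    have h := expectation_nonneg hT (qubitVec (i, j) (j, i) 1 (-1))
    simp only [expectation, pair, mul_assoc, ← Finset.mul_sum, sum_qubitVec,
      sum_star_qubitVec] at h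
    have h' := (Complex.nonneg_iff.1 h).1
    simp at h'
    linarith
  have hdiag : ∀ s, 0 ≤ (T s s).re := fun s => (Complex.nonneg_iff.1 hT.diag_nonneg).1
  have hle : (T (i, i) (i, i)).re + (T (j, j) (j, j)).re + (T (i, j) (i, j)).re +
      (T (j, i) (j, i)).re ≤ 2 := by
    have h := Finset.sum_le_sum_of_subset_of_nonneg
      (Finset.subset_univ ({(i, i), (j, j), (i, j), (j, i)} : Finset (X × X)))
      (fun s _ _ => hdiag s)
    have h2 : ∑ s, (T s s).re = 2 := by
      rw [← Complex.re_sum, hTtr]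
      norm_num
    rw [h2, Finset.sum_insert (by simp [hij]), Finset.sum_insert (by simp [hij.symm]),
      Finset.sum_insert (by simp [hij]), Finset.sum_singleton] at h
    linarith
  -- With the weights of `qubitForm_sum` the six bounds add up to `24 (1 - 2ε)`, while the right
  -- side is at most `8 · 2 = 16`.
  linarith

end NoCloning

/-! ### From codes to cloners -/

section Codes

/-- Product inputs `e_c ⊗ φ` suffice: Charlie's factor is left untouched, so the fidelity is that of
Bob's output with `φ`. Entanglement with Charlie is not needed for the converse. -/
theorem fidelity_output {AI AO BI BO : Type*} [Fintype AI] [Fintype AO] [Fintype BI] [Fintype BO]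
    [DecidableEq AI] [DecidableEq BI] {n m : ℕ} (P : Protocol AI AO BI BO n m)
    (W : ProcOp AI AO BI BO) (hP : (P.overall W).PosSemidef) (c : Fin m) (φ : Fin m → ℂ)
    (hφ : ∑ a, φ a * star (φ a) = 1) :
    ∃ σ, IsState σ ∧
      fidelity σ (P.output W σ) = (expectation (applyPure (P.overall W) φ) φ).re := by
  let ψ : Fin m × Fin m → ℂ := fun u => if u.1 = c then φ u.2 else 0
  have hψ : star ψ ⬝ᵥ ψ = 1 := by
    rw [← hφ]
    simp [dotProduct, ψ, Fintype.sum_prod_type, apply_ite (starRingEnd ℂ), mul_comm]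
  have heq : star ψ ⬝ᵥ (P.output W (Matrix.vecMulVec ψ (star ψ)) *ᵥ ψ) =
      expectation (applyPure (P.overall W) φ) φ := by
    rw [expectation_eq_dotProduct]
    simp only [dotProduct, Matrix.mulVec, Protocol.output, Matrix.of_apply, ψ, applyPure, pair,
      Matrix.vecMulVec_apply, Pi.star_apply, Fintype.sum_prod_type]
    rw [Finset.sum_eq_single c (by
      intro b _ hb
      simp [hb]) (by simp)]
    refine Finset.sum_congr rfl fun u _ => ?_
    rw [Finset.sum_eq_single c (by
      intro b _ hb
      simp [hb]) (by simp)]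
    simp
  refine ⟨Matrix.vecMulVec ψ (star ψ), ⟨Matrix.posSemidef_vecMulVec_self_star ψ, ?_⟩, ?_⟩
  · rw [Matrix.trace_vecMulVec, dotProduct_comm, hψ]
  · rw [fidelity_vecMulVec ψ hψ _ (by
      rw [heq]
      exact expectation_nonneg (posSemidef_applyPure hP φ) φ), heq]

variable {AI AO BI BO : Type*} [Fintype AI] [Fintype AO] [Fintype BI] [Fintype BO]
  [DecidableEq AI] [DecidableEq AO] [DecidableEq BI] [DecidableEq BO]
  [Nonempty AI] [Nonempty AO] [Nonempty BI] [Nonempty BO]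
  {W₁ W₂ : ProcOp AI AO BI BO}

theorem overall_eq_transmit {n m : ℕ} (P : Protocol AI AO BI BO n m) (W : ProcOp AI AO BI BO) :
    P.overall W = transmit P.EA P.EB P.DB (Matrix.of fun u v => ∏ i,
      useProcess W (P.A i) (P.B i) (((), u.1 i), (u.2.1 i, u.2.2 i))
        (((), v.1 i), (v.2.1 i, v.2.2 i))) := by
  ext u v
  simp only [Protocol.overall, transmit, pair, Matrix.of_apply, Finset.mul_sum]
  refine Finset.sum_congr rfl fun _ _ => Finset.sum_congr rfl fun _ _ =>
    Finset.sum_congr rfl fun _ _ => Finset.sum_congr rfl fun _ _ =>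
    Finset.sum_congr rfl fun _ _ => Finset.sum_congr rfl fun _ _ => by ring

/-- Each use of a process which is useless for Alice with probability at least one half yields a
channel with a symmetric extension. -/
theorem exists_isExtension (hW₁ : IsProcessMatrix W₁) (hW₂ : IsProcessMatrix W₂)
    (hno : NoSignalAtoB W₂) {p : ℝ} (hp0 : 0 ≤ p) (hp : p ≤ 1 / 2) {a b c : ℕ}
    (ha : Nonempty (Fin a))
    {A : Matrix ((AO × Unit) × (AI × Fin a)) ((AO × Unit) × (AI × Fin a)) ℂ}
    {B : Matrix ((BO × Fin c) × (BI × Fin b)) ((BO × Fin c) × (BI × Fin b)) ℂ}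
    (hA : IsChannel A) (hB : IsChannel B) :
    ∃ K, IsExtension (Matrix.of fun u v : Fin c × (Fin a × Fin b) =>
      useProcess ((p : ℂ) • W₁ + ((1 - p : ℝ) : ℂ) • W₂) A B (((), u.1), u.2) (((), v.1), v.2))
      K := by
  obtain ⟨M, hM, hMeq⟩ := hno.exists_eq hW₂ ha hA hB
  -- Half of `V` plus half of `W₂` is the given mixture; its weights are nonnegative precisely
  -- because `0 ≤ p ≤ 1/2`.
  let V : ProcOp AI AO BI BO := ((2 * p : ℝ) : ℂ) • W₁ + ((1 - 2 * p : ℝ) : ℂ) • W₂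
  let N : Matrix (Fin c × (Fin a × Fin b)) (Fin c × (Fin a × Fin b)) ℂ :=
    (useProcess V A B).submatrix (fun u => (((), u.1), u.2)) fun u => (((), u.1), u.2)
  have hN : IsChannel N := by
    refine ⟨(posSemidef_useProcess ?_ hA.posSemidef hB.posSemidef).submatrix _, ?_⟩
    · exact (hW₁.posSemidef.smul (Complex.zero_le_real.2 (by linarith))).add
        (hW₂.posSemidef.smul (Complex.zero_le_real.2 (by linarith)))
    · ext ⟨x, y⟩ ⟨x', y'⟩
      simp only [traceOut, N, V, useProcess_linear, Matrix.of_apply, Matrix.submatrix_apply,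
        Matrix.add_apply, Matrix.smul_apply, smul_eq_mul, Finset.sum_add_distrib,
        ← Finset.mul_sum, hW₁.sum_useProcess hA hB, hW₂.sum_useProcess hA hB, Matrix.one_apply,
        Prod.mk.injEq, ite_and]
      push_cast
      split_ifs <;> ring
  have h := isExtension_mixture hN hM
  have e : (Matrix.of fun u v : Fin c × (Fin a × Fin b) =>
      useProcess ((p : ℂ) • W₁ + ((1 - p : ℝ) : ℂ) • W₂) A B (((), u.1), u.2) (((), v.1), v.2)) =
      Matrix.of fun u v => (1 / 2 : ℂ) * N u v +
        (1 / 2) * if u.2.1 = v.2.1 then M (u.1, u.2.2) (v.1, v.2.2) else 0 := by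
    ext ⟨z, x, y⟩ ⟨z', x', y'⟩
    simp only [← hMeq, Matrix.of_apply, N, V, useProcess_linear, Matrix.submatrix_apply,
      Matrix.add_apply, Matrix.smul_apply, smul_eq_mul]
    push_cast
    ring
  rw [e]
  exact ⟨_, h⟩

/-- A code for more than one-dimensional messages has an error of at least `1/6`. -/
theorem HasCode.error_ge (hW₁ : IsProcessMatrix W₁) (hW₂ : IsProcessMatrix W₂)
    (hno : NoSignalAtoB W₂) {p : ℝ} (hp0 : 0 ≤ p) (hp : p ≤ 1 / 2) {R : ℝ} (hR : 0 < R) {n : ℕ}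
    {ε : ℝ} (h : HasCode ((p : ℂ) • W₁ + ((1 - p : ℝ) : ℂ) • W₂) R n ε) : 1 / 6 ≤ ε := by
  obtain ⟨m, hm, hRm, P, hP⟩ := h
  -- For `m = 1` the logarithm vanishes, contradicting `R > 0`.
  have hm2 : 2 ≤ m := by
    by_contra hlt
    obtain rfl : m = 1 := by omega
    simp at hRm
    linarith
  -- An empty ancilla would leave the encoder without output space, and it could not preserve the
  -- trace of a message.
  have haIn : ∀ i, Nonempty (Fin (P.aIn i)) := by
    by_contra hne
    obtain ⟨i, hi⟩ := not_forall.1 hne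
    rw [not_nonempty_iff] at hi
    have hs := P.isChannel_EA.sum_eq ⟨0, hm⟩ ⟨0, hm⟩
    have : IsEmpty (∀ i, Fin (P.aIn i)) := ⟨fun x => hi.elim (x i)⟩
    simp at hs
  choose K hK using fun i => exists_isExtension hW₁ hW₂ hno hp0 hp (haIn i) (P.isChannel_A i)
    (P.isChannel_B i)
  have hext := isExtension_prod hK
  have hΦ := overall_eq_transmit P ((p : ℂ) • W₁ + ((1 - p : ℝ) : ℂ) • W₂)
  simp only [Matrix.of_apply] at hext
  have hpos := posSemidef_transmit P.isChannel_EA.posSemidef P.isState_EB P.isChannel_DB hext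
  refine no_cloning (i := (⟨0, hm⟩ : Fin m)) (j := ⟨1, hm2⟩) (by simp)
    (posSemidef_transmitTwo P.isChannel_EA.posSemidef P.isState_EB.posSemidef
      P.isChannel_DB.posSemidef hext.posSemidef)
    (sum_transmitTwo_right P.isState_EB P.isChannel_DB hext)
    (sum_transmitTwo_left P.isState_EB P.isChannel_DB hext)
    (sum_transmit P.isChannel_EA P.isState_EB P.isChannel_DB hext) fun φ hφ => ?_
  rw [← hΦ] at hpos ⊢
  obtain ⟨σ, hσ, hfid⟩ := fidelity_output P _ hpos ⟨0, hm⟩ φ hφ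
  exact (hP σ hσ).trans hfid.le

theorem capacityAtoB_nonpos (hW₁ : IsProcessMatrix W₁) (hW₂ : IsProcessMatrix W₂)
    (hno : NoSignalAtoB W₂) {p : ℝ} (hp0 : 0 ≤ p) (hp : p ≤ 1 / 2) :
    ¬ 0 < capacityAtoB ((p : ℂ) • W₁ + ((1 - p : ℝ) : ℂ) • W₂) := by
  intro h
  obtain ⟨_, ⟨R, ⟨ε, hε, hcode⟩, rfl⟩, hR⟩ := lt_sSup_iff.1 h
  have hR' : 0 < R := EReal.coe_pos.1 hR
  obtain ⟨n, hn, hlt⟩ := ((Filter.eventually_ge_atTop 1).and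
    (hε.eventually (gt_mem_nhds (show (0 : ℝ) < 1 / 6 by norm_num)))).exists
  linarith [(hcode n hn).error_ge hW₁ hW₂ hno hp0 hp hR']

end Codes

end CausalComm
end

theorem corollary1 {AI AO BI BO : Type*}
    [Fintype AI] [Fintype AO] [Fintype BI] [Fintype BO]
    [DecidableEq AI] [DecidableEq AO] [DecidableEq BI] [DecidableEq BO]
    [Nonempty AI] [Nonempty AO] [Nonempty BI] [Nonempty BO]
    (W₁ W₂ : CausalComm.ProcOp AI AO BI BO)
    (hW₁ : CausalComm.IsProcessMatrix W₁) (hAB : CausalComm.NoSignalBtoA W₁)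
    (hW₂ : CausalComm.IsProcessMatrix W₂) (hBA : CausalComm.NoSignalAtoB W₂)
    (p : ℝ) (hp0 : 0 ≤ p) (hp1 : p ≤ 1) :
    ¬ (0 < CausalComm.capacityAtoB ((p : ℂ) • W₁ + ((1 - p : ℝ) : ℂ) • W₂) ∧
       0 < CausalComm.capacityBtoA ((p : ℂ) • W₁ + ((1 - p : ℝ) : ℂ) • W₂)) := by
  rintro ⟨h₁, h₂⟩
  rcases le_total p (1 / 2) with hp | hp
  · exact CausalComm.capacityAtoB_nonpos hW₁ hW₂ hBA hp0 hp h₁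
  -- For `p ≥ 1/2` the parties change roles: `W₁` becomes the useless component, with weight `p`.
  · refine CausalComm.capacityAtoB_nonpos (p := 1 - p) hW₂.swap hW₁.swap
      (show CausalComm.NoSignalBtoA _ from hAB) (by linarith) (by linarith) ?_
    rw [sub_sub_cancel, add_comm]
    exact h₂
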